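/- Let $d, M \ge 1$ be integers, let $p \in \mathbb{R}[x_1,\dots,x_d]$ be a polynomial of total degree at most $2M$ with $p(\xi) \ge 0$ for all $\xi \in \mathbb{R}^d$, and let $t \in [0,1)$ and $\varepsilon > 0$ be real numbers. For $q = \sum_{\alpha} q_\alpha x^\alpha \in \mathbb{R}[x_1,\dots,x_d]$ put $$\|q\| := \sum_{\alpha \in \mathbb{N}_0^d} |q_\alpha|\,\sqrt{\alpha!}, \qquad \alpha! := \prod_{j=1}^d \alpha_j!,$$ and set $$\mu := M \binom{2M+d-1}{d-1}^{1/2} 2^{M+\frac12} .$$ Let $N_{\mathrm{expl}}(p/\varepsilon) \in \mathbb{N}_0$ be the maximum of $$2M + \left\lceil \frac{5d}{2} \right\rceil + 2$$ and $$\left\lceil 2\mathrm{e}\,\bigl(4\mu\,\|p/\varepsilon\|\bigr)^{\frac{1}{1-t}} \right\rceil + \max\left\{0,\ \left\lceil \frac{1}{1-t} \ln\!\left( \frac{(d+1)^2\, 2^{2d}\, \|p/\varepsilon\|}{\mu} \right) \right\rceil \right\} + \left\lfloor \frac{3d}{2} \right\rfloor + 1,$$ where $\mathrm{e}$ is Euler's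 number and, if $p = 0$, the inner maximum is read as $0$. Then $$p + \varepsilon \sum_{n=0}^{N_{\mathrm{expl}}(p/\varepsilon)} \frac{1}{(n!)^t} \Bigl( \sum_{j=1}^d x_j^2 \Bigr)^{n}$$ is a sum of squares of polynomials in $\mathbb{R}[x_1,\dots,x_d]$. -/

import Mathlib

namespace SOSPerturbation

noncomputable section

/-- The weighted coefficient norm `‖q‖ = ∑_α |q_α| (α!)^{1/2}`, with `α! = ∏_j α_j!`. -/
def coeffNorm {d : ℕ} (q : MvPolynomial (Fin d) ℝ) : ℝ :=
  ∑ α ∈ q.support, |q.coeff α| * Real.sqrt (∏ j, ((α j).factorial : ℝ))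

/-- The constant `μ = M * binom(2M+d-1, d-1)^{1/2} * 2^{M+1/2}` (for `1 ≤ d`). -/
def mu (d M : ℕ) : ℝ :=
  (M : ℝ) * Real.sqrt ((Nat.choose (2 * M + d - 1) (d - 1) : ℕ) : ℝ) *
    (2 : ℝ) ^ ((M : ℝ) + 1 / 2)

/-- The explicit truncation order of `q`. All integers below are nonnegative, so `Int.toNat` only
changes the type; for `q = 0` the value `Real.log 0 = 0` gives the same maximum as `-∞` would. -/
def Nexpl {d : ℕ} (M : ℕ) (t : ℝ) (q : MvPolynomial (Fin d) ℝ) : ℕ :=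
  (max
    (2 * (M : ℤ) + ⌈5 * (d : ℝ) / 2⌉ + 2)
    (⌈2 * Real.exp 1 * (4 * mu d M * coeffNorm q) ^ (1 / (1 - t))⌉
      + max 0
          ⌈1 / (1 - t) *
            Real.log (((d : ℝ) + 1) ^ 2 * 2 ^ (2 * d) * coeffNorm q / mu d M)⌉
      + ⌊3 * (d : ℝ) / 2⌋ + 1)).toNat

/-- The polynomial `∑_{n=0}^N (x_1^2 + ⋯ + x_d^2)^n / (n!)^t`. -/
def perturbation (d : ℕ) (t : ℝ) (N : ℕ) : MvPolynomial (Fin d) ℝ :=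
  ∑ n ∈ Finset.range (N + 1),
    MvPolynomial.C (1 / (n.factorial : ℝ) ^ t) * (∑ j : Fin d, MvPolynomial.X j ^ 2) ^ n

end

end SOSPerturbation

/-! ### One-variable Gaussian integrals -/

namespace SOSPerturbation

open Polynomial MeasureTheory

/-! Dividing by `ε` reduces to `ε = 1`; let `x` be the coefficient norm of `q = p/ε`. By the
multinomial theorem (`perturbation_eq`) the perturbation is `∑ w_β z^{2β}` over `|β| ≤ N`, with `w_β
= (|β|!)^{1-t}/β! ≥ 1/β!`. If `x ≤ 1`, AM-GM absorbs every term of `q` (`isSumSq_of_sum_abs_le`).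

If `x ≥ 1`, replace `q` by its Gaussian average `z ↦ E q(z + y)`, where the coordinates of `y` are
independent, centred, of variance `1/(2τ)`, and `τ = 2Mx`. With `K(ξ,z) = exp(τ ξ·z - τ|z|²/2) = ∑
H_β(ξ) z^β`, completing the square gives `E q(z + y) = ∫ q K(·,z)² dν`, where `ν` is the law of `y`.
So the average has the infinite Gram matrix `G_{βγ} = ∫ q H_β H_γ dν`, and every finite section is
positive semidefinite because `q ≥ 0` (`gram_posSemidef`).

Cutting to `|β|, |γ| ≤ N` gives a sum of squares whose entries with `|β| + |γ| ≤ N` reproduce the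
average exactly (`sum_gram_mono`). Two errors remain. The difference between `q` and its average has
norm at most `3/4` (`sum_abs_sub_avg_le`, `averaging_estimate`) and is absorbed by `(3/4) ∑
z^{2β}/β!`. The entries with `|β| + |γ| > N` are so small that diagonal dominance absorbs them in
`(1/4) ∑ w_β z^{2β}` (`sum_abs_gramTail_le`). About `N` only `N ≥ 2M` and `N ≥ 2e(4μx)^{1/(1-t)}`
are needed. -/

/-- The unnormalised Gaussian integral `∫ f(x) exp(-b x²) dx` of a real polynomial. -/
noncomputable def gaussInt (b : ℝ) (f : ℝ[X]) : ℝ := ∫ x : ℝ, f.eval x * Real.exp (-b * x ^ 2)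

lemma integrable_eval_mul_gaussian {b : ℝ} (hb : 0 < b) (f : ℝ[X]) :
    Integrable fun x : ℝ => f.eval x * Real.exp (-b * x ^ 2) := by
  induction f using Polynomial.induction_on' with
  | add p q hp hq =>
    simp only [eval_add, add_mul]
    exact hp.add hq
  | monomial n a =>
    have h := (integrable_rpow_mul_exp_neg_mul_sq hb (s := n) (by
      have : (0 : ℝ) ≤ n := n.cast_nonneg
      linarith)).const_mul a
    simpa [eval_monomial, mul_assoc] using h

lemma gaussInt_add {b : ℝ} (hb : 0 < b) (f g : ℝ[X]) :
    gaussInt b (f + g) = gaussInt b f + gaussInt b g := by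
  simp only [gaussInt, eval_add, add_mul]
  exact integral_add (integrable_eval_mul_gaussian hb f) (integrable_eval_mul_gaussian hb g)

lemma gaussInt_C_mul (b c : ℝ) (f : ℝ[X]) : gaussInt b (C c * f) = c * gaussInt b f := by
  simp only [gaussInt, eval_mul, eval_C, mul_assoc]
  exact integral_const_mul _ _

lemma gaussInt_sub {b : ℝ} (hb : 0 < b) (f g : ℝ[X]) :
    gaussInt b (f - g) = gaussInt b f - gaussInt b g := by
  simp only [gaussInt, eval_sub, sub_mul]
  exact integral_sub (integrable_eval_mul_gaussian hb f) (integrable_eval_mul_gaussian hb g)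

lemma gaussInt_sum {b : ℝ} (hb : 0 < b) {ι : Type*} (s : Finset ι) (f : ι → ℝ[X]) :
    gaussInt b (∑ i ∈ s, f i) = ∑ i ∈ s, gaussInt b (f i) := by
  simp only [gaussInt, eval_finsetSum, Finset.sum_mul]
  exact integral_finsetSum _ fun i _ => integrable_eval_mul_gaussian hb (f i)

lemma gaussInt_one (b : ℝ) : gaussInt b 1 = √(Real.pi / b) := by
  simpa [gaussInt] using integral_gaussian b

/-- Gaussian integration by parts. -/
lemma gaussInt_two_mul_X_mul {b : ℝ} (hb : 0 < b) (f : ℝ[X]) :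
    gaussInt b (C (2 * b) * X * f) = gaussInt b (derivative f) := by
  have hd : ∀ x : ℝ, HasDerivAt (fun x : ℝ => f.eval x * Real.exp (-b * x ^ 2))
      ((derivative f - C (2 * b) * X * f).eval x * Real.exp (-b * x ^ 2)) x := by
    intro x
    have h2 : HasDerivAt (fun x : ℝ => Real.exp (-b * x ^ 2))
        (Real.exp (-b * x ^ 2) * (-b * (2 * x))) x := by
      have := ((hasDerivAt_pow 2 x).const_mul (-b)).exp
      simpa using this
    refine ((f.hasDerivAt x).mul h2).congr_deriv ?_
    simp only [eval_sub, eval_mul, eval_C, eval_X]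
    ring
  have h0 := integral_eq_zero_of_hasDerivAt_of_integrable hd
    (integrable_eval_mul_gaussian hb _) (integrable_eval_mul_gaussian hb f)
  have h1 : gaussInt b (derivative f - C (2 * b) * X * f) = 0 := h0
  rw [gaussInt_sub hb] at h1
  linarith

/-! ### Rescaled Hermite polynomials and their Cauchy square -/

/-- The coefficients of the generating function `exp(τ x z - τ z² / 2) = ∑ₙ Hₙ(x) zⁿ`: rescaled
Hermite polynomials divided by `n!`. -/
noncomputable def herm (τ : ℝ) : ℕ → ℝ[X]
  | 0 => 1
  | n + 1 => C ((n + 1 : ℝ)⁻¹) * (C τ * X * herm τ n - derivative (herm τ n))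

lemma succ_mul_herm (τ : ℝ) (n : ℕ) :
    C (n + 1 : ℝ) * herm τ (n + 1) = C τ * X * herm τ n - derivative (herm τ n) := by
  rw [herm, ← mul_assoc, ← C_mul, mul_inv_cancel₀ (by positivity), C_1, one_mul]

lemma derivative_herm (τ : ℝ) (n : ℕ) :
    derivative (herm τ (n + 1)) = C τ * herm τ n := by
  induction n with
  | zero => simp [herm]
  | succ n ih =>
    have hc : (C ((n : ℝ) + 1 + 1) : ℝ[X]) ≠ 0 := by
      rw [Ne, C_eq_zero]; positivity
    apply mul_left_cancel₀ hc
    have h := congrArg derivative (succ_mul_herm τ (n + 1))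
    have h2 := succ_mul_herm τ n
    simp only [derivative_mul, derivative_sub, derivative_C, derivative_X, ih, zero_mul, zero_add,
      mul_one] at h
    push_cast at h
    rw [h]
    simp only [map_add, map_one] at h2 ⊢
    linear_combination -C τ * h2

/-- The Cauchy square of the sequence `herm τ`. -/
noncomputable def hermSq (τ : ℝ) (n : ℕ) : ℝ[X] :=
  ∑ p ∈ Finset.HasAntidiagonal.antidiagonal n, herm τ p.1 * herm τ p.2

/-- The generating function of `hermSq τ` is `exp(2τxz - τz²)`; this is its `x`-derivative, and
`succ_mul_hermSq` combines it with the `z`-derivative. -/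
lemma derivative_hermSq (τ : ℝ) (n : ℕ) :
    derivative (hermSq τ (n + 1)) = C (2 * τ) * hermSq τ n := by
  simp only [hermSq, derivative_sum, derivative_mul, Finset.sum_add_distrib]
  rw [Finset.Nat.sum_antidiagonal_succ, Finset.Nat.sum_antidiagonal_succ']
  simp only [derivative_herm]
  simp only [herm, derivative_one, zero_mul, mul_zero, zero_add, Finset.mul_sum,
    ← Finset.sum_add_distrib, C_mul]
  refine Finset.sum_congr rfl fun p _ => ?_
  rw [show (C 2 : ℝ[X]) = 2 from rfl]
  ring

lemma succ_mul_hermSq (τ : ℝ) (n : ℕ) :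
    C (n + 1 : ℝ) * hermSq τ (n + 1) =
      C (2 * τ) * X * hermSq τ n - derivative (hermSq τ n) := by
  have h1 : C (n + 1 : ℝ) * hermSq τ (n + 1) =
      ∑ p ∈ Finset.HasAntidiagonal.antidiagonal (n + 1), C (p.1 : ℝ) * herm τ p.1 * herm τ p.2 +
      ∑ p ∈ Finset.HasAntidiagonal.antidiagonal (n + 1), herm τ p.1 * (C (p.2 : ℝ) * herm τ p.2) := by
    rw [hermSq, Finset.mul_sum, ← Finset.sum_add_distrib]
    refine Finset.sum_congr rfl fun p hp => ?_
    have : (p.1 : ℝ) + p.2 = n + 1 := by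
      exact_mod_cast Finset.HasAntidiagonal.mem_antidiagonal.mp hp
    rw [← this, C_add]
    ring
  rw [h1, Finset.Nat.sum_antidiagonal_succ, Finset.Nat.sum_antidiagonal_succ']
  simp only [Nat.cast_zero, C_0, zero_mul, mul_zero, zero_add, Nat.cast_succ,
    succ_mul_herm]
  simp only [hermSq, derivative_sum, derivative_mul, Finset.mul_sum, ← Finset.sum_add_distrib,
    ← Finset.sum_sub_distrib, C_mul]
  refine Finset.sum_congr rfl fun p _ => ?_
  rw [show (C 2 : ℝ[X]) = 2 from rfl]
  ring

/-! ### Gaussian averages of monomials -/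

/-- The coefficient of `xⁿ` in the Gaussian average of `(x + y)ᵃ`, where `y` has
variance `1 / (2τ)`. -/
noncomputable def avgCoeff (τ : ℝ) : ℕ → ℕ → ℝ
  | 0, 0 => 1
  | 0, _ + 1 => 0
  | a + 1, 0 => (2 * τ)⁻¹ * avgCoeff τ a 1
  | a + 1, n + 1 => (2 * τ)⁻¹ * (n + 2) * avgCoeff τ a (n + 2) + avgCoeff τ a n

/-- Coefficient form of `exp(-τx²) exp(2τxz - τz²) = exp(-τ(x - z)²)`. The induction on `a` uses
that multiplying `hermSq` by `X` obeys the recursion defining `avgCoeff`; for `a = 0`, integration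
by parts kills all positive indices. -/
lemma gaussInt_X_pow_mul_hermSq {τ : ℝ} (hτ : 0 < τ) (a n : ℕ) :
    gaussInt τ (X ^ a * hermSq τ n) = √(Real.pi / τ) * avgCoeff τ a n := by
  induction a generalizing n with
  | zero =>
    cases n with
    | zero => simp [hermSq, herm, avgCoeff, gaussInt_one]
    | succ n =>
      have h := congrArg (gaussInt τ) (succ_mul_hermSq τ n)
      rw [gaussInt_C_mul, gaussInt_sub hτ, gaussInt_two_mul_X_mul hτ, sub_self] at h
      have : ((n : ℝ) + 1) ≠ 0 := by positivity
      simpa [avgCoeff, this] using h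
  | succ a ih =>
    have h2 : (2 * τ) ≠ 0 := by positivity
    cases n with
    | zero =>
      have e : X ^ (a + 1) * hermSq τ 0 = C (2 * τ)⁻¹ * (X ^ a * hermSq τ 1) := by
        have := succ_mul_hermSq τ 0
        have h0 : derivative (hermSq τ 0) = 0 := by simp [hermSq, herm]
        have hc : C (2 * τ)⁻¹ * C (2 * τ) = 1 := by rw [← C_mul, inv_mul_cancel₀ h2, C_1]
        rw [h0] at this
        simp only [Nat.cast_zero, zero_add, C_1, one_mul, sub_zero] at this
        rw [this]
        linear_combination (-X ^ (a + 1) * hermSq τ 0) * hc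
      rw [e, gaussInt_C_mul, ih, avgCoeff]
      ring
    | succ n =>
      have e : X ^ (a + 1) * hermSq τ (n + 1) =
          C ((2 * τ)⁻¹ * (n + 2)) * (X ^ a * hermSq τ (n + 2)) + X ^ a * hermSq τ n := by
        have := succ_mul_hermSq τ (n + 1)
        rw [derivative_hermSq] at this
        have hc : C (2 * τ)⁻¹ * C (2 * τ) = 1 := by rw [← C_mul, inv_mul_cancel₀ h2, C_1]
        have h3 : ((n + 1 : ℕ) : ℝ) + 1 = n + 2 := by push_cast; ring
        rw [h3] at this
        rw [C_mul]
        linear_combination (-X ^ (a + 1) * hermSq τ (n + 1) + X ^ a * hermSq τ n) * hc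
          - C (2 * τ)⁻¹ * X ^ a * this
      rw [e, gaussInt_add hτ, gaussInt_C_mul, ih, ih, avgCoeff]
      ring

lemma avgCoeff_nonneg {τ : ℝ} (hτ : 0 < τ) (a n : ℕ) : 0 ≤ avgCoeff τ a n := by
  induction a generalizing n with
  | zero => cases n <;> simp [avgCoeff]
  | succ a ih =>
    cases n with
    | zero => rw [avgCoeff]; exact mul_nonneg (by positivity) (ih _)
    | succ n =>
      rw [avgCoeff]
      exact add_nonneg (mul_nonneg (by positivity) (ih _)) (ih _)

lemma avgCoeff_eq_zero (τ : ℝ) {a n : ℕ} (h : a < n) : avgCoeff τ a n = 0 := by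
  induction a generalizing n with
  | zero =>
    cases n with
    | zero => omega
    | succ n => rw [avgCoeff]
  | succ a ih =>
    cases n with
    | zero => omega
    | succ n => rw [avgCoeff, ih (by omega), ih (by omega)]; ring

lemma avgCoeff_self (τ : ℝ) (a : ℕ) : avgCoeff τ a a = 1 := by
  induction a with
  | zero => rw [avgCoeff]
  | succ a ih => rw [avgCoeff, ih, avgCoeff_eq_zero τ (by omega)]; ring

/-- If `A_a(z) = E(z + y)^a`, then `A_{a+1} = z A_a + (2τ)⁻¹ A_a'`. On polynomials of degree at most
`a`, multiplication by `z` and differentiation each enlarge the norm with weights `√n!` by at most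
`√(a+1)`. -/
lemma sum_avgCoeff_mul_sqrt_factorial_le {τ : ℝ} (hτ : 0 < τ) (a K : ℕ) :
    ∑ n ∈ Finset.range K, avgCoeff τ a n * √(n.factorial : ℝ) ≤
      (1 + (2 * τ)⁻¹) ^ a * √(a.factorial : ℝ) := by
  induction a generalizing K with
  | zero =>
    cases K with
    | zero => simp
    | succ K => rw [Finset.sum_range_succ']; simp [avgCoeff]
  | succ a ih =>
    set S : ℕ → ℝ := fun K => ∑ n ∈ Finset.range K, avgCoeff τ a n * √(n.factorial : ℝ) with hS
    have hτ' : 0 < (2 * τ)⁻¹ := by positivity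
    have hfac : ∀ n : ℕ, √((n + 1).factorial : ℝ) = √(n + 1 : ℝ) * √(n.factorial : ℝ) := by
      intro n
      rw [← Real.sqrt_mul (by positivity), Nat.factorial_succ]
      push_cast
      rfl
    have hterm : ∀ n : ℕ, ((n : ℝ) + 1) * avgCoeff τ a (n + 1) * √(n.factorial : ℝ) ≤
        √(a + 1 : ℝ) * (avgCoeff τ a (n + 1) * √((n + 1).factorial : ℝ)) := by
      intro n
      rcases lt_or_ge a (n + 1) with h | h
      · simp [avgCoeff_eq_zero τ h]
      · have h1 : √(n + 1 : ℝ) ≤ √(a + 1 : ℝ) := by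
          apply Real.sqrt_le_sqrt
          have : ((n + 1 : ℕ) : ℝ) ≤ a := by exact_mod_cast h
          push_cast at this
          linarith
        have h2 : (n : ℝ) + 1 = √(n + 1 : ℝ) * √(n + 1 : ℝ) :=
          (Real.mul_self_sqrt (by positivity)).symm
        calc ((n : ℝ) + 1) * avgCoeff τ a (n + 1) * √(n.factorial : ℝ)
            = √(n + 1 : ℝ) * (avgCoeff τ a (n + 1) * √((n + 1).factorial : ℝ)) := by
              rw [hfac]
              nth_rewrite 1 [h2]
              ring
          _ ≤ _ := mul_le_mul_of_nonneg_right h1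
              (mul_nonneg (avgCoeff_nonneg hτ _ _) (Real.sqrt_nonneg _))
    have hterm2 : ∀ n : ℕ, avgCoeff τ a n * √((n + 1).factorial : ℝ) ≤
        √(a + 1 : ℝ) * (avgCoeff τ a n * √(n.factorial : ℝ)) := by
      intro n
      rcases lt_or_ge a n with h | h
      · simp [avgCoeff_eq_zero τ h]
      · have h1 : √(n + 1 : ℝ) ≤ √(a + 1 : ℝ) := by
          apply Real.sqrt_le_sqrt
          have : (n : ℝ) ≤ a := by exact_mod_cast h
          linarith
        rw [hfac]
        calc _ = √(n + 1 : ℝ) * (avgCoeff τ a n * √(n.factorial : ℝ)) := by ring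
          _ ≤ _ := mul_le_mul_of_nonneg_right h1
              (mul_nonneg (avgCoeff_nonneg hτ _ _) (Real.sqrt_nonneg _))
    have hsplit : ∀ K, ∑ n ∈ Finset.range (K + 1), avgCoeff τ (a + 1) n * √(n.factorial : ℝ) =
        (2 * τ)⁻¹ * ∑ n ∈ Finset.range (K + 1),
          (((n : ℝ) + 1) * avgCoeff τ a (n + 1) * √(n.factorial : ℝ)) +
        ∑ n ∈ Finset.range K, avgCoeff τ a n * √((n + 1).factorial : ℝ) := by
      intro K
      rw [Finset.sum_range_succ', Finset.sum_range_succ' _ K, mul_add, Finset.mul_sum,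
        add_right_comm, ← Finset.sum_add_distrib]
      congr 1
      · refine Finset.sum_congr rfl fun n _ => ?_
        rw [avgCoeff]
        push_cast
        ring
      · rw [avgCoeff]
        push_cast
        ring
    have hbound : ∀ K, ∑ n ∈ Finset.range (K + 1), avgCoeff τ (a + 1) n * √(n.factorial : ℝ) ≤
        (2 * τ)⁻¹ * (√(a + 1 : ℝ) * S (K + 2)) + √(a + 1 : ℝ) * S K := by
      intro K
      rw [hsplit]
      refine add_le_add (mul_le_mul_of_nonneg_left ?_ hτ'.le) ?_
      · refine (Finset.sum_le_sum fun n _ => hterm n).trans ?_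
        rw [← Finset.mul_sum]
        refine mul_le_mul_of_nonneg_left ?_ (Real.sqrt_nonneg _)
        simp only [hS]
        rw [Finset.sum_range_succ' _ (K + 1)]
        exact le_add_of_nonneg_right (mul_nonneg (avgCoeff_nonneg hτ _ _) (Real.sqrt_nonneg _))
      · refine (Finset.sum_le_sum fun n _ => hterm2 n).trans ?_
        rw [← Finset.mul_sum]
    cases K with
    | zero => simp; positivity
    | succ K =>
      refine (hbound K).trans ?_
      have i1 := ih (K + 2)
      have i2 := ih K
      rw [hfac, pow_succ]
      have h0 : 0 ≤ √(a + 1 : ℝ) := Real.sqrt_nonneg _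
      calc (2 * τ)⁻¹ * (√(a + 1 : ℝ) * S (K + 2)) + √(a + 1 : ℝ) * S K
          ≤ (2 * τ)⁻¹ * (√(a + 1 : ℝ) * ((1 + (2 * τ)⁻¹) ^ a * √(a.factorial : ℝ))) +
            √(a + 1 : ℝ) * ((1 + (2 * τ)⁻¹) ^ a * √(a.factorial : ℝ)) := by gcongr
        _ = _ := by ring

/-! ### Hermite moments and their size -/

/-- The moments `∫ xᵃ H_b H_c` against the Gaussian probability measure of variance `1 / (2τ)`. -/
noncomputable def hermMoment (τ : ℝ) (a b c : ℕ) : ℝ :=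
  (√(Real.pi / τ))⁻¹ * gaussInt τ (X ^ a * herm τ b * herm τ c)

lemma sum_antidiagonal_hermMoment {τ : ℝ} (hτ : 0 < τ) (a n : ℕ) :
    ∑ p ∈ Finset.HasAntidiagonal.antidiagonal n, hermMoment τ a p.1 p.2 = avgCoeff τ a n := by
  have hpos : 0 < √(Real.pi / τ) := Real.sqrt_pos.mpr (div_pos Real.pi_pos hτ)
  simp only [hermMoment, ← Finset.mul_sum, mul_assoc]
  rw [← gaussInt_sum hτ, ← Finset.mul_sum, ← hermSq, gaussInt_X_pow_mul_hermSq hτ,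
    inv_mul_cancel_left₀ hpos.ne']

/-- The weight `exp(-τx²/2)`, not `exp(-τx²)`, is the one for which the `herm τ n` are orthogonal,
so integration by parts yields their norms. -/
lemma gaussInt_herm_mul_self {τ : ℝ} (hτ : 0 < τ) (n : ℕ) :
    gaussInt (τ / 2) (herm τ n * herm τ n) =
      √(Real.pi / (τ / 2)) * (τ ^ n / n.factorial) := by
  have hτ2 : 0 < τ / 2 := by positivity
  induction n with
  | zero => simp [herm, gaussInt_one]
  | succ n ih =>
    have e : C (n + 1 : ℝ) * (herm τ (n + 1) * herm τ (n + 1)) =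
        C (2 * (τ / 2)) * X * (herm τ n * herm τ (n + 1)) -
          derivative (herm τ n) * herm τ (n + 1) := by
      have := succ_mul_herm τ n
      rw [show 2 * (τ / 2) = τ by ring]
      linear_combination herm τ (n + 1) * this
    have h := congrArg (gaussInt (τ / 2)) e
    rw [gaussInt_C_mul, gaussInt_sub hτ2, gaussInt_two_mul_X_mul hτ2, derivative_mul,
      gaussInt_add hτ2, derivative_herm, add_sub_cancel_left,
      show herm τ n * (C τ * herm τ n) = C τ * (herm τ n * herm τ n) by ring, gaussInt_C_mul,
      ih] at h
    have hn : (n + 1 : ℝ) ≠ 0 := by positivity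
    apply mul_left_cancel₀ hn
    rw [h, Nat.factorial_succ, pow_succ]
    push_cast
    field_simp

lemma abs_pow_le_sqrt_factorial_mul_exp (x : ℝ) (a : ℕ) :
    |x| ^ a ≤ √(a.factorial : ℝ) * Real.exp (x ^ 2 / 2) := by
  have h := Real.pow_div_factorial_le_exp _ (sq_nonneg x) a
  have hf : (0 : ℝ) < a.factorial := by positivity
  rw [div_le_iff₀ hf] at h
  refine abs_le_of_sq_le_sq' ?_ (by positivity) |>.2
  rw [mul_pow, Real.sq_sqrt hf.le, ← Real.exp_nat_mul, ← pow_mul, mul_comm a 2, pow_mul, sq_abs]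
  calc _ ≤ _ := h
    _ = _ := by
      rw [mul_comm]
      congr 2
      push_cast
      ring

/-- Half of the Gaussian exponent pays for `|x|^a`, which is possible since `τ ≥ 1`; the other half
is the weight in which `f` and `g` have norms `A` and `B`. What remains is Cauchy-Schwarz. -/
lemma abs_gaussInt_le {τ : ℝ} (hτ : 1 ≤ τ) (a : ℕ) (f g : ℝ[X]) {A B : ℝ} (hA : 0 < A)
    (hB : 0 < B) (hf : gaussInt (τ / 2) (f * f) = A ^ 2) (hg : gaussInt (τ / 2) (g * g) = B ^ 2) :
    |gaussInt τ (X ^ a * f * g)| ≤ √(a.factorial : ℝ) * (A * B) := by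
  have hτ0 : 0 < τ := by linarith
  have hτ2 : 0 < τ / 2 := by positivity
  -- AM-GM majorant of `|f g|`, with weights balanced so that its integral is exactly `A * B`.
  set F : ℝ[X] := C (B / (2 * A)) * (f * f) + C (A / (2 * B)) * (g * g) with hF
  have hFint : gaussInt (τ / 2) F = A * B := by
    rw [hF, gaussInt_add hτ2, gaussInt_C_mul, gaussInt_C_mul, hf, hg]
    field_simp
    ring
  rw [← hFint, ← gaussInt_C_mul]
  rw [← Real.norm_eq_abs]
  refine norm_integral_le_of_norm_le (integrable_eval_mul_gaussian hτ2 _)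
    (Filter.Eventually.of_forall fun x => ?_)
  rw [Real.norm_eq_abs, abs_mul, Real.abs_exp]
  simp only [hF, eval_mul, eval_pow, eval_X, eval_C, eval_add, abs_mul, abs_pow]
  set u := f.eval x
  set v := g.eval x
  have h1 : |u| * |v| ≤ B / (2 * A) * (u * u) + A / (2 * B) * (v * v) := by
    have e : B / (2 * A) * (u * u) + A / (2 * B) * (v * v) - |u| * |v| =
        (B * |u| - A * |v|) ^ 2 / (2 * A * B) := by
      rw [← abs_mul_abs_self u, ← abs_mul_abs_self v]
      field_simp
      ring
    have : 0 ≤ (B * |u| - A * |v|) ^ 2 / (2 * A * B) := by positivity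
    linarith
  have h2 : |x| ^ a * Real.exp (-τ * x ^ 2) ≤
      √(a.factorial : ℝ) * Real.exp (-(τ / 2) * x ^ 2) := by
    calc |x| ^ a * Real.exp (-τ * x ^ 2)
        ≤ √(a.factorial : ℝ) * Real.exp (x ^ 2 / 2) * Real.exp (-τ * x ^ 2) := by
          gcongr
          exact abs_pow_le_sqrt_factorial_mul_exp x a
      _ = √(a.factorial : ℝ) * Real.exp (x ^ 2 / 2 + -τ * x ^ 2) := by
          rw [Real.exp_add]; ring
      _ ≤ _ := by
          gcongr
          nlinarith [sq_nonneg x]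
  calc |x| ^ a * |u| * |v| * Real.exp (-τ * x ^ 2)
      = (|x| ^ a * Real.exp (-τ * x ^ 2)) * (|u| * |v|) := by ring
    _ ≤ (√(a.factorial : ℝ) * Real.exp (-(τ / 2) * x ^ 2)) *
        (B / (2 * A) * (u * u) + A / (2 * B) * (v * v)) := by gcongr
    _ = _ := by ring

lemma abs_hermMoment_le {τ : ℝ} (hτ : 1 ≤ τ) (a b c : ℕ) :
    |hermMoment τ a b c| ≤ √2 * √(a.factorial : ℝ) *
      √(τ ^ b / b.factorial) * √(τ ^ c / c.factorial) := by
  have hτ0 : 0 < τ := by linarith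
  have hπ := Real.pi_pos
  set P := √(Real.pi / (τ / 2)) with hP
  have hP0 : 0 < P := Real.sqrt_pos.mpr (by positivity)
  have key : ∀ n : ℕ, gaussInt (τ / 2) (herm τ n * herm τ n) =
      (√P * √(τ ^ n / n.factorial)) ^ 2 := by
    intro n
    rw [gaussInt_herm_mul_self hτ0, mul_pow, Real.sq_sqrt hP0.le, Real.sq_sqrt (by positivity)]
  have h := abs_gaussInt_le hτ a (herm τ b) (herm τ c) (by positivity) (by positivity)
    (key b) (key c)
  have hPP : √P * √P = P := Real.mul_self_sqrt hP0.le
  -- The factor `√2` is the ratio of the total masses of the two Gaussian weights.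
  have hs : P = √2 * √(Real.pi / τ) := by
    rw [hP, ← Real.sqrt_mul (by norm_num)]
    congr 1
    field_simp
  have hpos : 0 < √(Real.pi / τ) := Real.sqrt_pos.mpr (by positivity)
  rw [hermMoment, abs_mul, abs_of_pos (inv_pos.mpr hpos), inv_mul_le_iff₀ hpos]
  refine h.trans (le_of_eq ?_)
  calc _ = √(a.factorial : ℝ) * (√P * √P) * √(τ ^ b / b.factorial) * √(τ ^ c / c.factorial) := by
        ring
    _ = _ := by rw [hPP, hs]; ring

end SOSPerturbation

/-! ### Sum-of-squares certificates -/

namespace SOSPerturbation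

open MvPolynomial

variable {d : ℕ}

lemma isSumSq_C_mul {a : ℝ} (ha : 0 ≤ a) {f : MvPolynomial (Fin d) ℝ} (hf : IsSumSq f) :
    IsSumSq (C a * f) := by
  refine IsSumSq.mul ?_ hf
  rw [← Real.mul_self_sqrt ha, C_mul]
  exact IsSumSq.mul_self _

lemma isSumSq_sq (f : MvPolynomial (Fin d) ℝ) : IsSumSq (f ^ 2) := by
  rw [sq]
  exact IsSumSq.mul_self f

lemma isSumSq_add {f g : MvPolynomial (Fin d) ℝ} (hf : IsSumSq f) (hg : IsSumSq g) :
    IsSumSq (f + g) :=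
  hf.add hg

lemma isSumSq_cross (c : ℝ) {a b : ℝ} (ha : 0 < a) (hb : 0 < b) (f g : MvPolynomial (Fin d) ℝ) :
    IsSumSq (C c * (f * g) + (C (|c| / 2 * (a / b)) * f ^ 2 + C (|c| / 2 * (b / a)) * g ^ 2)) := by
  -- `s` is a sign of `c`; it turns the expression into one multiple of a perfect square.
  have key : ∀ s : ℝ, s ^ 2 = 1 → c = s * |c| →
      C c * (f * g) + (C (|c| / 2 * (a / b)) * f ^ 2 + C (|c| / 2 * (b / a)) * g ^ 2) =
        C (|c| / (2 * a * b)) * (C a * f + C (s * b) * g) ^ 2 := by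
    intro s hs hc
    have e1 : |c| / 2 * (a / b) = |c| / (2 * a * b) * (a * a) := by field_simp
    have e2 : |c| / 2 * (b / a) = |c| / (2 * a * b) * ((s * b) * (s * b)) := by
      rw [show (s * b) * (s * b) = s ^ 2 * (b * b) by ring, hs]
      field_simp
    have e3 : c = |c| / (2 * a * b) * (2 * a * (s * b)) := by
      rw [div_mul_eq_mul_div, eq_div_iff (by positivity)]
      linear_combination (2 * a * b) * hc
    rw [e1, e2]
    nth_rewrite 1 [e3]
    simp only [C_mul]
    rw [show (C 2 : MvPolynomial (Fin d) ℝ) = 2 from rfl]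
    ring
  rcases le_total 0 c with h | h
  · rw [key 1 (by norm_num) (by rw [abs_of_nonneg h, one_mul])]
    exact isSumSq_C_mul (by positivity) (isSumSq_sq _)
  · rw [key (-1) (by norm_num) (by rw [abs_of_nonpos h]; ring)]
    exact isSumSq_C_mul (by positivity) (isSumSq_sq _)

/-- A weighted form of "symmetric diagonally dominant matrices give sums of squares". -/
lemma isSumSq_of_dominant {ι : Type*} (I : Finset ι) (m : ι → MvPolynomial (Fin d) ℝ)
    (E : ι → ι → ℝ) (hE : ∀ i j, E i j = E j i) (ω w : ι → ℝ) (hω : ∀ i, 0 < ω i)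
    (h : ∀ i ∈ I, ∑ j ∈ I, |E i j| * (ω i / ω j) ≤ w i) :
    IsSumSq (∑ i ∈ I, ∑ j ∈ I, C (E i j) * (m i * m j) + ∑ i ∈ I, C (w i) * m i ^ 2) := by
  have h1 : IsSumSq (∑ i ∈ I, ∑ j ∈ I, (C (E i j) * (m i * m j) +
      (C (|E i j| / 2 * (ω i / ω j)) * m i ^ 2 + C (|E i j| / 2 * (ω j / ω i)) * m j ^ 2))) :=
    IsSumSq.sum fun i _ => IsSumSq.sum fun j _ => isSumSq_cross _ (hω i) (hω j) _ _
  have h2 : IsSumSq (∑ i ∈ I, C (w i - ∑ j ∈ I, |E i j| * (ω i / ω j)) * m i ^ 2) :=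
    IsSumSq.sum fun i hi => isSumSq_C_mul (sub_nonneg.mpr (h i hi)) (isSumSq_sq _)
  convert isSumSq_add h1 h2 using 1
  have h3 : ∑ i ∈ I, ∑ j ∈ I, C (|E i j| / 2 * (ω j / ω i)) * m j ^ 2 =
      ∑ i ∈ I, ∑ j ∈ I, C (|E i j| / 2 * (ω i / ω j)) * m i ^ 2 := by
    rw [Finset.sum_comm]
    refine Finset.sum_congr rfl fun i _ => Finset.sum_congr rfl fun j _ => ?_
    rw [hE j i]
  simp only [Finset.sum_add_distrib]
  rw [h3, add_assoc]
  congr 1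
  simp only [← Finset.sum_add_distrib]
  refine Finset.sum_congr rfl fun i _ => ?_
  simp only [← Finset.sum_mul, ← add_mul, ← map_sum, ← C_add]
  congr 2
  simp only [add_halves, add_sub_cancel]

lemma isSumSq_of_posSemidef {ι : Type*} (I : Finset ι) (m : ι → MvPolynomial (Fin d) ℝ)
    (G : ι → ι → ℝ) (hG : ∀ i j, G i j = G j i)
    (h : ∀ v : ι → ℝ, 0 ≤ ∑ i ∈ I, ∑ j ∈ I, v i * G i j * v j) :
    IsSumSq (∑ i ∈ I, ∑ j ∈ I, C (G i j) * (m i * m j)) := by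
  classical
  have hpsd : (Matrix.of fun i j : I => G i j).PosSemidef := by
    refine Matrix.posSemidef_iff_dotProduct_mulVec.mpr ⟨?_, fun x => ?_⟩
    · ext i j
      simp [Matrix.conjTranspose_apply, hG i j]
    · have := h fun i => if hi : i ∈ I then x ⟨i, hi⟩ else 0
      rw [← Finset.sum_coe_sort I] at this
      simp only [← Finset.sum_coe_sort I (fun j => _ * _)] at this
      simpa [dotProduct, Matrix.mulVec, Finset.mul_sum, mul_assoc] using this
  obtain ⟨k, v, hv⟩ := Matrix.posSemidef_iff_eq_sum_vecMulVec.mp hpsd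
  have hGv : ∀ i j : I, G i j = ∑ l, v l i * v l j := by
    intro i j
    have := congrFun (congrFun hv i) j
    simpa [Matrix.sum_apply, Matrix.vecMulVec_apply] using this
  have : ∑ i ∈ I, ∑ j ∈ I, C (G i j) * (m i * m j) =
      ∑ l, (∑ i : I, C (v l i) * m i) ^ 2 := by
    calc ∑ i ∈ I, ∑ j ∈ I, C (G i j) * (m i * m j)
        = ∑ i : I, ∑ j : I, C (G i j) * (m i * m j) := by
          rw [← Finset.sum_coe_sort I]
          exact Finset.sum_congr rfl fun i _ => (Finset.sum_coe_sort I _).symm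
      _ = ∑ i : I, ∑ j : I, ∑ l, (C (v l i) * m i) * (C (v l j) * m j) := by
          refine Finset.sum_congr rfl fun i _ => Finset.sum_congr rfl fun j _ => ?_
          rw [hGv, map_sum, Finset.sum_mul]
          refine Finset.sum_congr rfl fun l _ => ?_
          rw [C_mul]
          ring
      _ = ∑ l, ∑ i : I, ∑ j : I, (C (v l i) * m i) * (C (v l j) * m j) := by
          rw [Finset.sum_congr rfl fun i _ => Finset.sum_comm]
          exact Finset.sum_comm
      _ = _ := by
          refine Finset.sum_congr rfl fun l _ => ?_
          rw [sq, Finset.sum_mul_sum]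
  rw [this]
  exact IsSumSq.sum_sq _ _

/-! ### Multi-indices and the perturbation in the monomial basis -/

/-- The monomial `x^β`. -/
noncomputable def mono (β : Fin d → ℕ) : MvPolynomial (Fin d) ℝ := ∏ j, X j ^ β j

lemma mono_add (β γ : Fin d → ℕ) : mono (β + γ) = mono β * mono γ := by
  simp [mono, pow_add, Finset.prod_mul_distrib]

lemma mono_zero : mono (0 : Fin d → ℕ) = 1 := by simp [mono]

/-- The multi-index factorial `β! = ∏ⱼ βⱼ!`, as a real number. -/
noncomputable def mfact (β : Fin d → ℕ) : ℝ := ∏ j, ((β j).factorial : ℝ)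

lemma mfact_pos (β : Fin d → ℕ) : 0 < mfact β :=
  Finset.prod_pos fun _ _ => by positivity

/-- The multi-indices of length at most `N`. -/
def idx (d N : ℕ) : Finset (Fin d → ℕ) :=
  (Fintype.piFinset fun _ => Finset.range (N + 1)).filter fun β => ∑ j, β j ≤ N

lemma mem_idx {N : ℕ} {β : Fin d → ℕ} : β ∈ idx d N ↔ ∑ j, β j ≤ N := by
  simp only [idx, Finset.mem_filter, Fintype.mem_piFinset, Finset.mem_range, and_iff_right_iff_imp]
  intro h j
  have := Finset.single_le_sum (f := β) (fun _ _ => Nat.zero_le _) (Finset.mem_univ j)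
  omega

lemma idx_subset (d N : ℕ) : idx d N ⊆ Fintype.piFinset fun _ => Finset.range (N + 1) :=
  Finset.filter_subset _ _

lemma perturbation_eq (d : ℕ) (t : ℝ) (N : ℕ) :
    perturbation d t N =
      ∑ β ∈ idx d N, C (((∑ j, β j).factorial : ℝ) ^ (1 - t) / mfact β) * mono β ^ 2 := by
  have hmaps : ∀ β ∈ idx d N, ∑ j, β j ∈ Finset.range (N + 1) := fun β hβ => by
    rw [Finset.mem_range, Nat.lt_succ_iff]; exact mem_idx.mp hβ
  rw [perturbation, ← Finset.sum_fiberwise_of_maps_to hmaps]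
  refine Finset.sum_congr rfl fun n hn => ?_
  have hfil : (idx d N).filter (fun β => ∑ j, β j = n) = Finset.univ.piAntidiag n := by
    ext β
    simp only [Finset.mem_filter, mem_idx, Finset.mem_piAntidiag, Finset.mem_univ, implies_true,
      and_true]
    have := Finset.mem_range.mp hn
    exact ⟨fun h => h.2, fun h => ⟨h.le.trans (by omega), h⟩⟩
  rw [hfil, Finset.sum_pow_eq_sum_piAntidiag, Finset.mul_sum]
  refine Finset.sum_congr rfl fun β hβ => ?_
  have hs : ∑ j, β j = n := (Finset.mem_piAntidiag.mp hβ).1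
  have hspec := Nat.multinomial_spec Finset.univ β
  rw [hs] at hspec ⊢
  have hn0 : (0 : ℝ) < n.factorial := by positivity
  have e : (n.factorial : ℝ) ^ (1 - t) / mfact β =
      1 / (n.factorial : ℝ) ^ t * (Nat.multinomial Finset.univ β : ℝ) := by
    have h1 : mfact β * (Nat.multinomial Finset.univ β : ℝ) = n.factorial := by
      rw [mfact]; exact_mod_cast hspec
    have h2 := mfact_pos β
    have h3 : 0 < (n.factorial : ℝ) ^ t := Real.rpow_pos_of_pos hn0 t
    rw [Real.rpow_sub hn0, Real.rpow_one, ← h1]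
    field_simp
  have e2 : ∏ i, (X i ^ 2 : MvPolynomial (Fin d) ℝ) ^ β i = mono β ^ 2 := by
    rw [mono, ← Finset.prod_pow]
    exact Finset.prod_congr rfl fun i _ => by rw [← pow_mul, ← pow_mul, mul_comm]
  rw [e2, e, C_mul, map_natCast, mul_assoc]

/-- AM-GM on `c_δ z^δ · 1` costs `|c_δ|√δ!/2` times `z^{2δ}/δ!` and the same multiple of `1`. With
`S` the norm of `c`, each square `z^{2δ}/δ!` needs at most `S/2`, and the constants add up to
another `S/2`, taken from the index `0`. -/
lemma isSumSq_of_sum_abs_le (I : Finset (Fin d → ℕ)) (h0 : 0 ∈ I) (c : (Fin d → ℕ) → ℝ) {K : ℝ}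
    (hK : ∑ δ ∈ I, |c δ| * √(mfact δ) ≤ K) :
    IsSumSq (∑ δ ∈ I, C (c δ) * mono δ + ∑ β ∈ I, C (K / mfact β) * mono β ^ 2) := by
  have hs : ∀ δ : Fin d → ℕ, 0 < √(mfact δ) := fun δ => Real.sqrt_pos.mpr (mfact_pos δ)
  have hss : ∀ δ : Fin d → ℕ, √(mfact δ) * √(mfact δ) = mfact δ :=
    fun δ => Real.mul_self_sqrt (mfact_pos δ).le
  set S := ∑ δ ∈ I, |c δ| * √(mfact δ) with hS
  have hle : ∀ δ ∈ I, |c δ| * √(mfact δ) ≤ S := fun δ hδ =>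
    Finset.single_le_sum (f := fun δ => |c δ| * √(mfact δ))
      (fun _ _ => mul_nonneg (abs_nonneg _) (Real.sqrt_nonneg _)) hδ
  have hS0 : 0 ≤ S := Finset.sum_nonneg fun _ _ => mul_nonneg (abs_nonneg _) (Real.sqrt_nonneg _)
  have h1 : IsSumSq (∑ δ ∈ I, (C (c δ) * (mono δ * 1) +
      (C (|c δ| / 2 * (1 / √(mfact δ))) * mono δ ^ 2 +
        C (|c δ| / 2 * (√(mfact δ) / 1)) * 1 ^ 2))) :=
    IsSumSq.sum fun δ _ => isSumSq_cross _ one_pos (hs δ) _ _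
  have h2 : IsSumSq (∑ δ ∈ I, C ((K - S / 2) / mfact δ - |c δ| / 2 * (1 / √(mfact δ))) *
      mono δ ^ 2) := by
    refine IsSumSq.sum fun δ hδ => isSumSq_C_mul ?_ (isSumSq_sq _)
    have e : |c δ| / 2 * (1 / √(mfact δ)) = (|c δ| * √(mfact δ) / 2) / mfact δ := by
      rw [eq_div_iff (mfact_pos δ).ne']
      nth_rewrite 2 [← hss δ]
      field_simp [(hs δ).ne']
    rw [e, ← sub_div]
    have := hle δ hδ
    exact div_nonneg (by linarith) (mfact_pos δ).le
  have h3 : IsSumSq (∑ δ ∈ I.erase 0, C (S / 2 / mfact δ) * mono δ ^ 2) :=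
    IsSumSq.sum fun δ _ => isSumSq_C_mul
      (div_nonneg (by linarith) (mfact_pos δ).le) (isSumSq_sq _)
  convert isSumSq_add (isSumSq_add h1 h2) h3 using 1
  have e4 : ∑ δ ∈ I, C (S / 2 / mfact δ) * mono δ ^ 2 =
      C (S / 2) + ∑ δ ∈ I.erase 0, C (S / 2 / mfact δ) * mono δ ^ 2 := by
    rw [← Finset.add_sum_erase I _ h0, mono_zero]
    simp [mfact]
  have e5 : ∑ δ ∈ I, (C (|c δ| / 2 * (√(mfact δ) / 1)) * 1 ^ 2 : MvPolynomial (Fin d) ℝ) =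
      C (S / 2) := by
    simp only [one_pow, mul_one, div_one, ← map_sum]
    congr 1
    rw [hS, Finset.sum_div]
    exact Finset.sum_congr rfl fun δ _ => by ring
  have e6 : ∑ δ ∈ I, C (K / mfact δ) * mono δ ^ 2 =
      ∑ δ ∈ I, C ((K - S / 2) / mfact δ - |c δ| / 2 * (1 / √(mfact δ))) * mono δ ^ 2 +
      ∑ δ ∈ I, C (|c δ| / 2 * (1 / √(mfact δ))) * mono δ ^ 2 +
      ∑ δ ∈ I, C (S / 2 / mfact δ) * mono δ ^ 2 := by
    simp only [← Finset.sum_add_distrib, ← add_mul, ← C_add]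
    refine Finset.sum_congr rfl fun δ _ => ?_
    congr 2
    ring
  rw [Finset.sum_add_distrib, Finset.sum_add_distrib, e5, e6, e4]
  simp only [mul_one]
  ring

/-! ### Numerical estimates -/

lemma two_sqrt_two_le_rpow {M : ℕ} (hM : 1 ≤ M) : 2 * √2 ≤ (2 : ℝ) ^ ((M : ℝ) + 1 / 2) := by
  have h1 : (1 : ℝ) ≤ M := by exact_mod_cast hM
  calc 2 * √2 = (2 : ℝ) ^ ((1 : ℝ) + 1 / 2) := by
        rw [Real.rpow_add (by norm_num), Real.rpow_one, Real.sqrt_eq_rpow]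
    _ ≤ _ := Real.rpow_le_rpow_of_exponent_le (by norm_num) (by linarith)

lemma two_mul_le_mu_right {d M : ℕ} (hM : 1 ≤ M) : 2 * (M : ℝ) ≤ mu d M := by
  have h1 : (1 : ℝ) ≤ √((Nat.choose (2 * M + d - 1) (d - 1) : ℕ) : ℝ) := by
    rw [Real.one_le_sqrt]
    exact_mod_cast Nat.choose_pos (by omega)
  have h2 := two_sqrt_two_le_rpow hM
  have h3 : 1 ≤ √2 := by rw [Real.one_le_sqrt]; norm_num
  rw [mu]
  calc 2 * (M : ℝ) = M * 1 * 2 := by ring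
    _ ≤ _ := by gcongr; linarith

lemma two_mul_le_mu_left {d M : ℕ} (hd : 1 ≤ d) (hM : 1 ≤ M) : 2 * (d : ℝ) ≤ mu d M := by
  have hc : d * d ≤ 2 * Nat.choose (2 * M + d - 1) (d - 1) := by
    have h1 : Nat.choose (d + 1) (d - 1) ≤ Nat.choose (2 * M + d - 1) (d - 1) :=
      Nat.choose_le_choose _ (by omega)
    have h2 : Nat.choose (d + 1) (d - 1) = Nat.choose (d + 1) 2 :=
      Nat.choose_symm_of_eq_add (by omega)
    have h4 : (d + 1) * d = 2 * Nat.choose (d + 1) 2 := by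
      have := Nat.add_one_mul_choose_eq d 1
      simp only [Nat.choose_one_right] at this
      linarith
    nlinarith
  have h1 : (d : ℝ) / √2 ≤ √((Nat.choose (2 * M + d - 1) (d - 1) : ℕ) : ℝ) := by
    apply Real.le_sqrt_of_sq_le
    rw [div_pow, Real.sq_sqrt (by norm_num), div_le_iff₀ (by norm_num)]
    have : ((d * d : ℕ) : ℝ) ≤ ((2 * Nat.choose (2 * M + d - 1) (d - 1) : ℕ) : ℝ) := by
      exact_mod_cast hc
    push_cast at this
    linarith
  have h2 := two_sqrt_two_le_rpow hM
  have h3 : (1 : ℝ) ≤ M := by exact_mod_cast hM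
  rw [mu]
  calc 2 * (d : ℝ) = 1 * (d / √2) * (2 * √2) := by field_simp
    _ ≤ _ := by gcongr

lemma two_mul_le_Nexpl {d : ℕ} (M : ℕ) (t : ℝ) (q : MvPolynomial (Fin d) ℝ) :
    2 * M ≤ Nexpl M t q := by
  have h : 0 ≤ ⌈5 * (d : ℝ) / 2⌉ := Int.ceil_nonneg (by positivity)
  rw [Nexpl]
  zify
  refine le_trans ?_ (Int.self_le_toNat _)
  refine le_trans ?_ (le_max_left _ _)
  linarith

lemma two_exp_mul_rpow_le_Nexpl {d : ℕ} (M : ℕ) (t : ℝ) (q : MvPolynomial (Fin d) ℝ) :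
    2 * Real.exp 1 * (4 * mu d M * coeffNorm q) ^ (1 / (1 - t)) ≤ (Nexpl M t q : ℝ) := by
  have h : 0 ≤ ⌊3 * (d : ℝ) / 2⌋ := Int.floor_nonneg.mpr (by positivity)
  refine (Int.le_ceil _).trans ?_
  rw [Nexpl, ← Int.cast_natCast]
  refine Int.cast_le.mpr (le_trans ?_ (Int.self_le_toNat _))
  refine le_trans ?_ (le_max_right _ _)
  have := le_max_left (0 : ℤ) ⌈1 / (1 - t) *
    Real.log (((d : ℝ) + 1) ^ 2 * 2 ^ (2 * d) * coeffNorm q / mu d M)⌉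
  linarith

lemma two_mul_pow_le_factorial {R : ℝ} (hR : 0 ≤ R) {n : ℕ} (hn : 2 * Real.exp 1 * R ≤ n) :
    (2 * R) ^ n ≤ n.factorial := by
  have h := Real.pow_div_factorial_le_exp (n : ℝ) n.cast_nonneg n
  have hf : (0 : ℝ) < n.factorial := by positivity
  rw [div_le_iff₀ hf] at h
  have h2 : (2 * R * Real.exp 1) ^ n ≤ (n : ℝ) ^ n := by
    gcongr
    linarith
  rw [mul_pow, ← Real.exp_nat_mul, mul_one] at h2
  have h3 : (2 * R) ^ n * Real.exp n ≤ n.factorial * Real.exp n := by linarith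
  exact le_of_mul_le_mul_right h3 (Real.exp_pos _)

/-- With `R = r^{1/s}` and `n = b + c`, `(2R)^n ≤ (n/e)^n ≤ n! ≤ 2^n b! c!`. The factor `2` in the
hypothesis pays for the binomial coefficient. -/
lemma pow_le_factorial_mul_factorial_rpow {r s : ℝ} (hr : 0 ≤ r) (hs : 0 < s) {b c : ℕ}
    (h : 2 * Real.exp 1 * r ^ (1 / s) ≤ ((b + c : ℕ) : ℝ)) :
    r ^ (b + c) ≤ ((b.factorial : ℝ) * c.factorial) ^ s := by
  set R := r ^ (1 / s) with hRdef
  have hR : 0 ≤ R := Real.rpow_nonneg hr _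
  have h1 := two_mul_pow_le_factorial hR h
  have h2 : ((b + c).factorial : ℝ) ≤ 2 ^ (b + c) * (b.factorial * c.factorial) := by
    have h3 := Nat.add_choose_mul_factorial_mul_factorial b c
    have h4 := Nat.choose_le_two_pow (b + c) c
    rw [← h3]
    push_cast
    rw [mul_assoc]
    gcongr
    exact_mod_cast h4
  have h3 : R ^ (b + c) ≤ b.factorial * c.factorial := by
    rw [mul_pow] at h1
    exact le_of_mul_le_mul_left (h1.trans h2) (by positivity)
  calc r ^ (b + c) = (R ^ (b + c)) ^ s := by
        rw [hRdef, ← Real.rpow_natCast, ← Real.rpow_natCast, ← Real.rpow_mul hr,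
          ← Real.rpow_mul hr]
        congr 1
        field_simp
    _ ≤ _ := by gcongr

lemma tail_estimate {x : ℝ} (hx : 1 ≤ x) {d N : ℕ} (hd : 1 ≤ d) (hN : 40 * d * x ≤ N) :
    x * √2 ^ d * (3 / 4) ^ N * 3 ^ d ≤ 1 / 4 := by
  have hd1 : (1 : ℝ) ≤ d := by exact_mod_cast hd
  -- Of the `N` factors `3/4`, the first `12d` cancel `(3√2)^d`; the at least `28x` others beat `4x`
  -- by Bernoulli.
  have h12 : 12 * d ≤ N := by
    have : ((12 * d : ℕ) : ℝ) ≤ N := by push_cast; nlinarith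
    exact_mod_cast this
  obtain ⟨m, rfl⟩ := Nat.exists_eq_add_of_le h12
  have hm : 28 * x ≤ m := by push_cast at hN; nlinarith
  have hs : √2 ≤ 2 := by rw [Real.sqrt_le_left (by norm_num)]; norm_num
  have h1 : √2 ^ d * (3 / 4 : ℝ) ^ (12 * d) * 3 ^ d ≤ 1 := by
    rw [pow_mul, ← mul_pow, ← mul_pow]
    exact pow_le_one₀ (by positivity) (by norm_num; linarith)
  have hb := one_add_mul_le_pow (a := (1 / 3 : ℝ)) (by norm_num) m
  have h2 : x * (3 / 4 : ℝ) ^ m ≤ 1 / 4 := by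
    have e : (3 / 4 : ℝ) ^ m * (1 + 1 / 3) ^ m = 1 := by
      rw [← mul_pow]; norm_num
    have hp : (0 : ℝ) < (3 / 4 : ℝ) ^ m := by positivity
    have : (3 / 4 : ℝ) ^ m * (4 * x) ≤ (3 / 4 : ℝ) ^ m * (1 + 1 / 3) ^ m :=
      mul_le_mul_of_nonneg_left (by linarith) hp.le
    linarith
  calc x * √2 ^ d * (3 / 4) ^ (12 * d + m) * 3 ^ d
      = (√2 ^ d * (3 / 4 : ℝ) ^ (12 * d) * 3 ^ d) * (x * (3 / 4 : ℝ) ^ m) := by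
        rw [pow_add]; ring
    _ ≤ 1 * (1 / 4) := by gcongr
    _ = 1 / 4 := by ring

/-- For `τ = 2Mx` the power is at most `exp y` with `y = 1/(2x) ≤ 1/2`, and `x(y + y²) = (1 + y)/2 ≤
3/4`. -/
lemma averaging_estimate {x : ℝ} (hx : 1 ≤ x) {M : ℕ} (hM : 1 ≤ M) :
    x * ((1 + (2 * (2 * M * x))⁻¹) ^ (2 * M) - 1) ≤ 3 / 4 := by
  have hM1 : (1 : ℝ) ≤ M := by exact_mod_cast hM
  have h0 : 0 ≤ (2 * (2 * M * x))⁻¹ := by positivity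
  set y : ℝ := (2 * x)⁻¹ with hy
  have hy0 : 0 ≤ y := by positivity
  have hxy : x * y = 1 / 2 := by rw [hy]; field_simp
  have hy1 : y ≤ 1 / 2 := by nlinarith
  have h1 : (1 + (2 * (2 * M * x))⁻¹) ^ (2 * M) ≤ Real.exp y := by
    calc _ ≤ (Real.exp ((2 * (2 * M * x))⁻¹)) ^ (2 * M) := by
          gcongr
          linarith [Real.add_one_le_exp ((2 * (2 * M * x))⁻¹)]
      _ = Real.exp y := by
          rw [← Real.exp_nat_mul]
          congr 1
          rw [hy]
          push_cast
          field_simp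
  have h2 : Real.exp y ≤ 1 + y + y ^ 2 := by
    have := Real.abs_exp_sub_one_sub_id_le (x := y) (by rw [abs_of_nonneg hy0]; linarith)
    linarith [le_abs_self (Real.exp y - 1 - y)]
  calc x * ((1 + (2 * (2 * M * x))⁻¹) ^ (2 * M) - 1) ≤ x * (y + y ^ 2) := by
        gcongr; linarith
    _ = x * y + x * y * y := by ring
    _ ≤ 3 / 4 := by rw [hxy]; linarith

end SOSPerturbation

/-! ### The localised Gram matrix and the Gaussian average -/

namespace SOSPerturbation

open MvPolynomial MeasureTheory

variable {d : ℕ}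

lemma hermMoment_symm (τ : ℝ) (a b c : ℕ) : hermMoment τ a b c = hermMoment τ a c b := by
  rw [hermMoment, hermMoment, mul_right_comm]

/-- The localised Gram matrix `∫ p H_β H_γ` of the Gaussian measure for `p = ∑ c_α x^α`. -/
noncomputable def gram (τ : ℝ) (I : Finset (Fin d → ℕ)) (c : (Fin d → ℕ) → ℝ)
    (β γ : Fin d → ℕ) : ℝ :=
  ∑ α ∈ I, c α * ∏ j, hermMoment τ (α j) (β j) (γ j)

lemma gram_symm (τ : ℝ) (I : Finset (Fin d → ℕ)) (c : (Fin d → ℕ) → ℝ) (β γ : Fin d → ℕ) :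
    gram τ I c β γ = gram τ I c γ β := by
  simp only [gram]
  refine Finset.sum_congr rfl fun α _ => ?_
  congr 1
  exact Finset.prod_congr rfl fun j _ => hermMoment_symm _ _ _ _

lemma sqrt_pow_div_mfact {τ : ℝ} (hτ : 0 ≤ τ) (β : Fin d → ℕ) :
    ∏ j, √(τ ^ β j / (β j).factorial) = √(τ ^ (∑ j, β j) / mfact β) := by
  rw [← Finset.prod_pow_eq_pow_sum, mfact, ← Finset.prod_div_distrib,
    Real.sqrt_prod _ fun j _ => by positivity]

lemma sqrt_mfact (α : Fin d → ℕ) : √(mfact α) = ∏ j, √((α j).factorial : ℝ) := by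
  rw [mfact, Real.sqrt_prod _ fun j _ => by positivity]

lemma abs_gram_le {τ : ℝ} (hτ : 1 ≤ τ) (I : Finset (Fin d → ℕ)) (c : (Fin d → ℕ) → ℝ)
    (β γ : Fin d → ℕ) :
    |gram τ I c β γ| ≤ (∑ α ∈ I, |c α| * √(mfact α)) * √2 ^ d *
      (√(τ ^ (∑ j, β j) / mfact β) * √(τ ^ (∑ j, γ j) / mfact γ)) := by
  have hτ0 : 0 ≤ τ := by linarith
  rw [gram, mul_assoc, Finset.sum_mul]
  refine (Finset.abs_sum_le_sum_abs _ _).trans (Finset.sum_le_sum fun α _ => ?_)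
  rw [abs_mul, mul_assoc, Finset.abs_prod]
  refine mul_le_mul_of_nonneg_left ?_ (abs_nonneg _)
  refine (Finset.prod_le_prod (fun _ _ => abs_nonneg _)
    fun j _ => abs_hermMoment_le hτ (α j) (β j) (γ j)).trans (le_of_eq ?_)
  simp only [Finset.prod_mul_distrib, sqrt_pow_div_mfact hτ0, sqrt_mfact, Finset.prod_const,
    Finset.card_univ, Fintype.card_fin]
  ring

lemma prod_hermMoment (τ : ℝ) (α β γ : Fin d → ℕ) :
    ∏ j, hermMoment τ (α j) (β j) (γ j) = (√(Real.pi / τ))⁻¹ ^ d *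
      ∫ ξ : Fin d → ℝ, ∏ j, ((Polynomial.X ^ α j * herm τ (β j) * herm τ (γ j)).eval (ξ j) *
        Real.exp (-τ * ξ j ^ 2)) := by
  have h := integral_fintype_prod_volume_eq_prod (fun (j : Fin d) (x : ℝ) =>
    (Polynomial.X ^ α j * herm τ (β j) * herm τ (γ j)).eval x * Real.exp (-τ * x ^ 2))
  rw [h]
  simp [hermMoment, Finset.prod_mul_distrib, gaussInt]

/-- The quadratic form is the Gaussian integral of `p · (∑ v_β H_β)²`. This is the only place where
nonnegativity of the polynomial enters. -/
lemma gram_posSemidef {τ : ℝ} (hτ : 0 < τ) (I J : Finset (Fin d → ℕ)) (c : (Fin d → ℕ) → ℝ)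
    (hc : ∀ ξ : Fin d → ℝ, 0 ≤ ∑ α ∈ I, c α * ∏ j, ξ j ^ α j) (v : (Fin d → ℕ) → ℝ) :
    0 ≤ ∑ β ∈ J, ∑ γ ∈ J, v β * gram τ I c β γ * v γ := by
  set K : ℝ := (√(Real.pi / τ))⁻¹ ^ d with hK
  have hK0 : 0 ≤ K := by positivity
  set F : (Fin d → ℕ) → (Fin d → ℕ) → (Fin d → ℕ) → (Fin d → ℝ) → ℝ := fun α β γ ξ =>
    ∏ j, ((Polynomial.X ^ α j * herm τ (β j) * herm τ (γ j)).eval (ξ j) *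
      Real.exp (-τ * ξ j ^ 2)) with hF
  have hint : ∀ α β γ, Integrable (F α β γ) := fun α β γ =>
    Integrable.fintype_prod fun j => integrable_eval_mul_gaussian hτ _
  have hform : ∑ β ∈ J, ∑ γ ∈ J, v β * gram τ I c β γ * v γ =
      K * ∫ ξ, ∑ β ∈ J, ∑ γ ∈ J, ∑ α ∈ I, (v β * v γ * c α) * F α β γ ξ := by
    rw [integral_finsetSum _ fun β _ => integrable_finsetSum _ fun γ _ =>
      integrable_finsetSum _ fun α _ => (hint α β γ).const_mul _, Finset.mul_sum]
    refine Finset.sum_congr rfl fun β _ => ?_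
    rw [integral_finsetSum _ fun γ _ =>
      integrable_finsetSum _ fun α _ => (hint α β γ).const_mul _, Finset.mul_sum]
    refine Finset.sum_congr rfl fun γ _ => ?_
    rw [integral_finsetSum _ fun α _ => (hint α β γ).const_mul _, Finset.mul_sum, gram,
      Finset.mul_sum, Finset.sum_mul]
    refine Finset.sum_congr rfl fun α _ => ?_
    rw [integral_const_mul, prod_hermMoment]
    ring
  rw [hform]
  refine mul_nonneg hK0 (integral_nonneg fun ξ => ?_)
  have hsq : ∑ β ∈ J, ∑ γ ∈ J, ∑ α ∈ I, (v β * v γ * c α) * F α β γ ξ =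
      (∑ α ∈ I, c α * ∏ j, ξ j ^ α j) * (∑ β ∈ J, v β * ∏ j, (herm τ (β j)).eval (ξ j)) ^ 2 *
        ∏ j, Real.exp (-τ * ξ j ^ 2) := by
    rw [sq, Finset.sum_mul_sum, Finset.mul_sum, Finset.sum_mul]
    refine Finset.sum_congr rfl fun β _ => ?_
    rw [Finset.mul_sum, Finset.sum_mul]
    refine Finset.sum_congr rfl fun γ _ => ?_
    rw [Finset.sum_mul, Finset.sum_mul]
    refine Finset.sum_congr rfl fun α _ => ?_
    simp only [hF, Polynomial.eval_mul, Polynomial.eval_pow, Polynomial.eval_X,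
      Finset.prod_mul_distrib]
    ring
  simp only [Pi.zero_apply]
  rw [hsq]
  exact mul_nonneg (mul_nonneg (hc ξ) (sq_nonneg _))
    (Finset.prod_nonneg fun _ _ => (Real.exp_pos _).le)

lemma sum_antidiagonal_prod {N : ℕ} {δ : Fin d → ℕ} (hδ : δ ∈ idx d N)
    (f : Fin d → ℕ → ℕ → ℝ) :
    ∑ p ∈ (idx d N ×ˢ idx d N).filter (fun p => p.1 + p.2 = δ), ∏ j, f j (p.1 j) (p.2 j) =
      ∏ j, ∑ q ∈ Finset.HasAntidiagonal.antidiagonal (δ j), f j q.1 q.2 := by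
  rw [Finset.prod_univ_sum]
  refine Finset.sum_nbij' (fun p j => (p.1 j, p.2 j)) (fun x => (fun j => (x j).1, fun j => (x j).2))
    ?_ ?_ ?_ ?_ ?_
  · intro p hp
    simp only [Finset.mem_filter] at hp
    simp only [Fintype.mem_piFinset, Finset.HasAntidiagonal.mem_antidiagonal]
    exact fun j => congrFun hp.2 j
  · intro x hx
    simp only [Fintype.mem_piFinset, Finset.HasAntidiagonal.mem_antidiagonal] at hx
    have hN := mem_idx.mp hδ
    simp only [Finset.mem_filter, Finset.mem_product, mem_idx]
    refine ⟨⟨le_trans (Finset.sum_le_sum fun j _ => ?_) hN,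
      le_trans (Finset.sum_le_sum fun j _ => ?_) hN⟩, funext hx⟩
    · have := hx j; omega
    · have := hx j; omega
  · intro p _; rfl
  · intro x _; rfl
  · intro p _; rfl

/-- The coefficients of the Gaussian average `x ↦ E[p(x + y)]` of `p = ∑ c_α x^α`. -/
noncomputable def avg (τ : ℝ) (I : Finset (Fin d → ℕ)) (c : (Fin d → ℕ) → ℝ)
    (δ : Fin d → ℕ) : ℝ :=
  ∑ α ∈ I, c α * ∏ j, avgCoeff τ (α j) (δ j)

/-- For `|δ| ≤ N` every decomposition `β + γ = δ` survives the truncation, so the sum factors into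
full antidiagonals in each coordinate. -/
lemma sum_gram_eq_avg {τ : ℝ} (hτ : 0 < τ) {N : ℕ} (I : Finset (Fin d → ℕ))
    (c : (Fin d → ℕ) → ℝ) {δ : Fin d → ℕ} (hδ : δ ∈ idx d N) :
    ∑ p ∈ (idx d N ×ˢ idx d N).filter (fun p => p.1 + p.2 = δ), gram τ I c p.1 p.2 =
      avg τ I c δ := by
  simp only [gram, avg]
  rw [Finset.sum_comm]
  refine Finset.sum_congr rfl fun α _ => ?_
  rw [← Finset.mul_sum, sum_antidiagonal_prod hδ fun j => hermMoment τ (α j)]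
  congr 1
  exact Finset.prod_congr rfl fun j _ => sum_antidiagonal_hermMoment hτ _ _

/-- The entries of the Gram matrix that contribute to degrees above `N`. -/
noncomputable def gramTail (τ : ℝ) (N : ℕ) (I : Finset (Fin d → ℕ)) (c : (Fin d → ℕ) → ℝ)
    (β γ : Fin d → ℕ) : ℝ :=
  if ∑ j, β j + ∑ j, γ j ≤ N then 0 else gram τ I c β γ

lemma sum_gram_mono {τ : ℝ} (hτ : 0 < τ) (N : ℕ) (I : Finset (Fin d → ℕ))
    (c : (Fin d → ℕ) → ℝ) :
    ∑ β ∈ idx d N, ∑ γ ∈ idx d N, C (gram τ I c β γ) * (mono β * mono γ) =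
      ∑ δ ∈ idx d N, C (avg τ I c δ) * mono δ +
      ∑ β ∈ idx d N, ∑ γ ∈ idx d N, C (gramTail τ N I c β γ) * (mono β * mono γ) := by
  classical
  have hlow : ∑ p ∈ (idx d N ×ˢ idx d N).filter (fun p => ∑ j, p.1 j + ∑ j, p.2 j ≤ N),
      C (gram τ I c p.1 p.2) * (mono p.1 * mono p.2) =
      ∑ δ ∈ idx d N, C (avg τ I c δ) * mono δ := by
    have hmaps : ∀ p ∈ (idx d N ×ˢ idx d N).filter (fun p => ∑ j, p.1 j + ∑ j, p.2 j ≤ N),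
        p.1 + p.2 ∈ idx d N := by
      intro p hp
      rw [mem_idx]
      simpa [Finset.sum_add_distrib] using (Finset.mem_filter.mp hp).2
    rw [← Finset.sum_fiberwise_of_maps_to hmaps]
    refine Finset.sum_congr rfl fun δ hδ => ?_
    rw [← sum_gram_eq_avg hτ I c hδ, map_sum, Finset.sum_mul, Finset.filter_filter]
    have hfil : (idx d N ×ˢ idx d N).filter
        (fun p => ∑ j, p.1 j + ∑ j, p.2 j ≤ N ∧ p.1 + p.2 = δ) =
        (idx d N ×ˢ idx d N).filter (fun p => p.1 + p.2 = δ) := by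
      refine Finset.filter_congr fun p _ => and_iff_right_of_imp fun h => ?_
      have := mem_idx.mp hδ
      rw [← h] at this
      simpa [Finset.sum_add_distrib] using this
    rw [hfil]
    refine Finset.sum_congr rfl fun p hp => ?_
    rw [← mono_add, (Finset.mem_filter.mp hp).2]
  rw [← hlow, ← Finset.sum_product', ← Finset.sum_product', Finset.sum_filter,
    ← Finset.sum_add_distrib]
  refine Finset.sum_congr rfl fun p _ => ?_
  by_cases h : ∑ j, p.1 j + ∑ j, p.2 j ≤ N <;> simp [gramTail, h]

lemma sum_prod_avgCoeff_le {τ : ℝ} (hτ : 0 < τ) (N : ℕ) (α : Fin d → ℕ) :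
    ∑ δ ∈ idx d N, (∏ j, avgCoeff τ (α j) (δ j)) * √(mfact δ) ≤
      (1 + (2 * τ)⁻¹) ^ (∑ j, α j) * √(mfact α) := by
  calc ∑ δ ∈ idx d N, (∏ j, avgCoeff τ (α j) (δ j)) * √(mfact δ)
      ≤ ∑ δ ∈ Fintype.piFinset fun _ : Fin d => Finset.range (N + 1),
          (∏ j, avgCoeff τ (α j) (δ j)) * √(mfact δ) :=
        Finset.sum_le_sum_of_subset_of_nonneg (idx_subset d N) fun δ _ _ =>
          mul_nonneg (Finset.prod_nonneg fun j _ => avgCoeff_nonneg hτ _ _) (Real.sqrt_nonneg _)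
    _ = ∏ j, ∑ n ∈ Finset.range (N + 1), avgCoeff τ (α j) n * √(n.factorial : ℝ) := by
        rw [Finset.prod_univ_sum]
        refine Finset.sum_congr rfl fun δ _ => ?_
        rw [sqrt_mfact, ← Finset.prod_mul_distrib]
    _ ≤ ∏ j, ((1 + (2 * τ)⁻¹) ^ α j * √((α j).factorial : ℝ)) :=
        Finset.prod_le_prod
          (fun j _ => Finset.sum_nonneg fun n _ =>
            mul_nonneg (avgCoeff_nonneg hτ _ _) (Real.sqrt_nonneg _))
          fun j _ => sum_avgCoeff_mul_sqrt_factorial_le hτ _ _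
    _ = _ := by
        rw [Finset.prod_mul_distrib, Finset.prod_pow_eq_pow_sum, sqrt_mfact]

/-- The average of `z^α` has nonnegative coefficients and leading coefficient `1`. Hence the norm of
its difference from `z^α` is the norm of the average minus `√α!`. -/
lemma sum_abs_sub_avg_le {τ : ℝ} (hτ : 0 < τ) {N D : ℕ} (c : (Fin d → ℕ) → ℝ)
    (hc : ∀ α, D < ∑ j, α j → c α = 0) :
    ∑ δ ∈ idx d N, |c δ - avg τ (idx d N) c δ| * √(mfact δ) ≤
      (∑ α ∈ idx d N, |c α| * √(mfact α)) * ((1 + (2 * τ)⁻¹) ^ D - 1) := by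
  classical
  set A : (Fin d → ℕ) → (Fin d → ℕ) → ℝ := fun α δ => ∏ j, avgCoeff τ (α j) (δ j) with hA
  have hA0 : ∀ α δ, 0 ≤ A α δ := fun α δ => Finset.prod_nonneg fun j _ => avgCoeff_nonneg hτ _ _
  have hA1 : ∀ α, A α α = 1 := fun α => Finset.prod_eq_one fun j _ => avgCoeff_self _ _
  have habs : ∀ α δ, |(if α = δ then 1 else 0) - A α δ| = A α δ - if α = δ then 1 else 0 := by
    intro α δ
    by_cases h : α = δ
    · subst h; simp [hA1]
    · simp [h, abs_of_nonneg (hA0 α δ)]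
  have hdiff : ∀ δ ∈ idx d N, c δ - avg τ (idx d N) c δ =
      ∑ α ∈ idx d N, c α * ((if α = δ then 1 else 0) - A α δ) := by
    intro δ hδ
    simp only [mul_sub, Finset.sum_sub_distrib, mul_ite, mul_one, mul_zero,
      Finset.sum_ite_eq', hδ, if_true]
    rfl
  calc ∑ δ ∈ idx d N, |c δ - avg τ (idx d N) c δ| * √(mfact δ)
      ≤ ∑ δ ∈ idx d N, ∑ α ∈ idx d N,
          |c α| * ((A α δ - if α = δ then 1 else 0) * √(mfact δ)) := by
        refine Finset.sum_le_sum fun δ hδ => ?_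
        rw [hdiff δ hδ]
        refine (mul_le_mul_of_nonneg_right (Finset.abs_sum_le_sum_abs _ _)
          (Real.sqrt_nonneg _)).trans (le_of_eq ?_)
        rw [Finset.sum_mul]
        refine Finset.sum_congr rfl fun α _ => ?_
        rw [abs_mul, habs, mul_assoc]
    _ = ∑ α ∈ idx d N, |c α| * (∑ δ ∈ idx d N, A α δ * √(mfact δ) - √(mfact α)) := by
        rw [Finset.sum_comm]
        refine Finset.sum_congr rfl fun α hα => ?_
        rw [← Finset.mul_sum]
        simp only [sub_mul, Finset.sum_sub_distrib, ite_mul, one_mul, zero_mul,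
          Finset.sum_ite_eq, hα, if_true]
    _ ≤ ∑ α ∈ idx d N, |c α| * √(mfact α) * ((1 + (2 * τ)⁻¹) ^ D - 1) := by
        refine Finset.sum_le_sum fun α _ => ?_
        rcases lt_or_ge D (∑ j, α j) with h | h
        · simp [hc α h]
        · rw [mul_assoc]
          refine mul_le_mul_of_nonneg_left ?_ (abs_nonneg _)
          have h1 := sum_prod_avgCoeff_le hτ N α
          have h2 : (1 + (2 * τ)⁻¹) ^ (∑ j, α j) ≤ (1 + (2 * τ)⁻¹) ^ D :=
            pow_le_pow_right₀ (by linarith [inv_pos.mpr (mul_pos two_pos hτ)]) h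
          have h3 := mul_le_mul_of_nonneg_right h2 (Real.sqrt_nonneg (mfact α))
          linarith
    _ = _ := by rw [Finset.sum_mul]

lemma sum_idx_two_thirds_pow_le (d N : ℕ) :
    ∑ γ ∈ idx d N, (2 / 3 : ℝ) ^ (∑ j, γ j) ≤ 3 ^ d := by
  calc ∑ γ ∈ idx d N, (2 / 3 : ℝ) ^ (∑ j, γ j)
      ≤ ∑ γ ∈ Fintype.piFinset fun _ : Fin d => Finset.range (N + 1),
          (2 / 3 : ℝ) ^ (∑ j, γ j) :=
        Finset.sum_le_sum_of_subset_of_nonneg (idx_subset d N) fun γ _ _ => by positivity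
    _ = ∏ _j : Fin d, ∑ n ∈ Finset.range (N + 1), (2 / 3 : ℝ) ^ n := by
        rw [Finset.prod_univ_sum]
        exact Finset.sum_congr rfl fun γ _ => (Finset.prod_pow_eq_pow_sum _ _ _).symm
    _ ≤ ∏ _j : Fin d, (3 : ℝ) := by
        refine Finset.prod_le_prod (fun _ _ => by positivity) fun _ _ => ?_
        rw [geom_sum_eq (by norm_num)]
        have : (0 : ℝ) < (2 / 3) ^ (N + 1) := by positivity
        rw [div_le_iff_of_neg (by norm_num)]
        linarith
    _ = 3 ^ d := by simp

/-! ### Absorbing the tail of the Gram matrix -/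

/-- The coefficient of `x^{2β}` in the perturbation. -/
noncomputable def weight (t : ℝ) (β : Fin d → ℕ) : ℝ :=
  ((∑ j, β j).factorial : ℝ) ^ (1 - t) / mfact β

lemma weight_pos (t : ℝ) (β : Fin d → ℕ) : 0 < weight t β :=
  div_pos (Real.rpow_pos_of_pos (by positivity) _) (mfact_pos β)

lemma one_div_mfact_le_weight {t : ℝ} (ht : t < 1) (β : Fin d → ℕ) :
    1 / mfact β ≤ weight t β := by
  refine div_le_div_of_nonneg_right ?_ (mfact_pos β).le
  exact Real.one_le_rpow (by exact_mod_cast Nat.one_le_iff_ne_zero.mpr (Nat.factorial_ne_zero _))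
    (by linarith)

/-- After squaring and cancelling `β! γ!` this is `(4τ)^{b+c} ≤ (b! c!)^{1-t}`; the `4` in `4 * τ ≤
r` is what produces the decay `(1/2)^{b+c}`. -/
lemma sqrt_mul_sqrt_le_weight {τ r t : ℝ} (hτ : 0 ≤ τ) (hr : 4 * τ ≤ r) (ht : t < 1)
    (β γ : Fin d → ℕ)
    (h : 2 * Real.exp 1 * r ^ (1 / (1 - t)) ≤ ((∑ j, β j + ∑ j, γ j : ℕ) : ℝ)) :
    √(τ ^ (∑ j, β j) / mfact β) * √(τ ^ (∑ j, γ j) / mfact γ) ≤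
      (1 / 2) ^ (∑ j, β j + ∑ j, γ j) * (√(weight t β) * √(weight t γ)) := by
  have hβ := mfact_pos β
  have hγ := mfact_pos γ
  have hw := weight_pos t β
  rw [← Real.sqrt_mul (by positivity), ← Real.sqrt_mul hw.le]
  refine Real.sqrt_le_iff.mpr ⟨by positivity, ?_⟩
  rw [mul_pow, Real.sq_sqrt (mul_pos hw (weight_pos t γ)).le, weight, weight]
  set b := ∑ j, β j
  set c := ∑ j, γ j
  have h1 := pow_le_factorial_mul_factorial_rpow (r := r) (s := 1 - t) (by linarith)
    (by linarith) h
  have h2 : (4 * τ) ^ (b + c) ≤ r ^ (b + c) := by gcongr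
  rw [Real.mul_rpow (by positivity) (by positivity)] at h1
  have h3 : τ ^ (b + c) ≤ ((1 / 2 : ℝ) ^ (b + c)) ^ 2 *
      ((b.factorial : ℝ) ^ (1 - t) * (c.factorial : ℝ) ^ (1 - t)) := by
    calc τ ^ (b + c) = ((1 / 2 : ℝ) ^ (b + c)) ^ 2 * (4 * τ) ^ (b + c) := by
          rw [← pow_mul, mul_comm (b + c) 2, pow_mul, ← mul_pow]
          congr 1
          ring
      _ ≤ _ := by gcongr; exact h2.trans h1
  calc τ ^ b / mfact β * (τ ^ c / mfact γ) = τ ^ (b + c) / (mfact β * mfact γ) := by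
        rw [pow_add]; field_simp
    _ ≤ ((1 / 2 : ℝ) ^ (b + c)) ^ 2 *
      ((b.factorial : ℝ) ^ (1 - t) * (c.factorial : ℝ) ^ (1 - t)) / (mfact β * mfact γ) := by
        gcongr
    _ = _ := by field_simp

/-- Splitting `1/2 = (3/4)(2/3)` leaves one factor small in `N` and one summable over `γ`. -/
lemma half_pow_le {N b c : ℕ} (h : N ≤ b + c) :
    (1 / 2 : ℝ) ^ (b + c) ≤ (3 / 4) ^ N * (2 / 3) ^ c := by
  calc (1 / 2 : ℝ) ^ (b + c) = (3 / 4) ^ (b + c) * (2 / 3) ^ (b + c) := by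
        rw [← mul_pow]; norm_num
    _ ≤ _ := mul_le_mul (pow_le_pow_of_le_one (by norm_num) (by norm_num) h)
        (pow_le_pow_of_le_one (by norm_num) (by norm_num) (by omega)) (by positivity)
        (by positivity)

lemma sum_abs_gramTail_le {τ r t x : ℝ} (hτ : 1 ≤ τ) (hr : 4 * τ ≤ r) (ht : t < 1) {N : ℕ}
    (hN : 2 * Real.exp 1 * r ^ (1 / (1 - t)) ≤ N) (c : (Fin d → ℕ) → ℝ)
    (hx : ∑ α ∈ idx d N, |c α| * √(mfact α) = x)
    (hxN : x * √2 ^ d * (3 / 4) ^ N * 3 ^ d ≤ 1 / 4) (β : Fin d → ℕ) :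
    ∑ γ ∈ idx d N, |gramTail τ N (idx d N) c β γ| * (√(weight t β) / √(weight t γ)) ≤
      weight t β / 4 := by
  have hx0 : 0 ≤ x := hx ▸ Finset.sum_nonneg fun _ _ =>
    mul_nonneg (abs_nonneg _) (Real.sqrt_nonneg _)
  have hs : ∀ γ : Fin d → ℕ, 0 < √(weight t γ) := fun γ => Real.sqrt_pos.mpr (weight_pos t γ)
  have hterm : ∀ γ ∈ idx d N,
      |gramTail τ N (idx d N) c β γ| * (√(weight t β) / √(weight t γ)) ≤
        weight t β * (x * √2 ^ d * (3 / 4) ^ N) * (2 / 3) ^ (∑ j, γ j) := by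
    intro γ _
    have hw := weight_pos t β
    by_cases h : ∑ j, β j + ∑ j, γ j ≤ N
    · simp only [gramTail, h, if_true, abs_zero, zero_mul]
      positivity
    · push Not at h
      simp only [gramTail, not_le.mpr h, if_false]
      have h1 := abs_gram_le hτ (idx d N) c β γ
      rw [hx] at h1
      have h2 := sqrt_mul_sqrt_le_weight (by linarith) hr ht β γ
        (hN.trans (by exact_mod_cast h.le))
      have h3 := half_pow_le h.le
      have h4 : |gram τ (idx d N) c β γ| ≤ x * √2 ^ d *
          ((3 / 4) ^ N * (2 / 3) ^ (∑ j, γ j) * (√(weight t β) * √(weight t γ))) := by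
        refine h1.trans (mul_le_mul_of_nonneg_left (h2.trans ?_) (by positivity))
        exact mul_le_mul_of_nonneg_right h3 (mul_pos (hs β) (hs γ)).le
      calc _ ≤ x * √2 ^ d * ((3 / 4) ^ N * (2 / 3) ^ (∑ j, γ j) *
            (√(weight t β) * √(weight t γ))) * (√(weight t β) / √(weight t γ)) :=
            mul_le_mul_of_nonneg_right h4 (div_pos (hs β) (hs γ)).le
        _ = (√(weight t β) * √(weight t β)) * (x * √2 ^ d * (3 / 4) ^ N) *
            (2 / 3) ^ (∑ j, γ j) := by
            field_simp [(hs γ).ne']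
        _ = _ := by rw [Real.mul_self_sqrt hw.le]
  refine (Finset.sum_le_sum hterm).trans ?_
  rw [← Finset.mul_sum]
  have hw := weight_pos t β
  calc weight t β * (x * √2 ^ d * (3 / 4) ^ N) * ∑ γ ∈ idx d N, (2 / 3 : ℝ) ^ (∑ j, γ j)
      ≤ weight t β * (x * √2 ^ d * (3 / 4) ^ N) * 3 ^ d := by
        gcongr
        exact sum_idx_two_thirds_pow_le d N
    _ = weight t β * (x * √2 ^ d * (3 / 4) ^ N * 3 ^ d) := by ring
    _ ≤ weight t β * (1 / 4) := by gcongr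
    _ = _ := by ring

/-! ### Assembling the certificate -/

lemma zero_mem_idx (d N : ℕ) : (0 : Fin d → ℕ) ∈ idx d N := by simp [mem_idx]

lemma isSumSq_add_perturbation_of_le_one {t : ℝ} (ht : t < 1) {N : ℕ} (c : (Fin d → ℕ) → ℝ)
    (hx : ∑ α ∈ idx d N, |c α| * √(mfact α) ≤ 1) :
    IsSumSq (∑ δ ∈ idx d N, C (c δ) * mono δ + perturbation d t N) := by
  have h1 := isSumSq_of_sum_abs_le (idx d N) (zero_mem_idx d N) c hx
  have h2 : IsSumSq (∑ β ∈ idx d N, C (weight t β - 1 / mfact β) * mono β ^ 2) :=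
    IsSumSq.sum fun β _ => isSumSq_C_mul (sub_nonneg.mpr (one_div_mfact_le_weight ht β))
      (isSumSq_sq _)
  convert isSumSq_add h1 h2 using 1
  rw [perturbation_eq, add_assoc]
  congr 1
  rw [← Finset.sum_add_distrib]
  refine Finset.sum_congr rfl fun β _ => ?_
  rw [← add_mul, ← C_add, add_sub_cancel, weight]

lemma isSumSq_add_perturbation {M N : ℕ} (hd : 1 ≤ d) (hM : 1 ≤ M) {t x : ℝ} (ht0 : 0 ≤ t)
    (ht : t < 1) (c : (Fin d → ℕ) → ℝ) (hc : ∀ α, 2 * M < ∑ j, α j → c α = 0)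
    (hpos : ∀ ξ : Fin d → ℝ, 0 ≤ ∑ α ∈ idx d N, c α * ∏ j, ξ j ^ α j)
    (hx : ∑ α ∈ idx d N, |c α| * √(mfact α) = x) (hx1 : 1 ≤ x)
    (hN : 2 * Real.exp 1 * (4 * mu d M * x) ^ (1 / (1 - t)) ≤ N) :
    IsSumSq (∑ δ ∈ idx d N, C (c δ) * mono δ + perturbation d t N) := by
  have hM1 : (1 : ℝ) ≤ M := by exact_mod_cast hM
  have hd1 : (1 : ℝ) ≤ d := by exact_mod_cast hd
  have hmuM := two_mul_le_mu_right (d := d) hM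
  have hmud := two_mul_le_mu_left hd hM
  set τ : ℝ := 2 * M * x with hτdef
  set r : ℝ := 4 * mu d M * x with hrdef
  have hτ : 1 ≤ τ := by rw [hτdef]; nlinarith
  have hτ0 : 0 < τ := by linarith
  -- This uses `μ ≥ 2M`; the next bound uses `μ ≥ 2d`, `r ≥ 1` and `2e ≥ 5`.
  have hr : 4 * τ ≤ r := by rw [hτdef, hrdef]; nlinarith
  have hr1 : 1 ≤ r := by linarith
  have hNr : 40 * d * x ≤ N := by
    have h1 : r ≤ r ^ (1 / (1 - t)) := by
      refine Real.self_le_rpow_of_one_le hr1 ?_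
      rw [le_div_iff₀ (by linarith)]
      linarith
    have h2 : (2.5 : ℝ) ≤ Real.exp 1 := by linarith [Real.exp_one_gt_d9]
    have h3 : 8 * d * x ≤ r := by rw [hrdef]; nlinarith
    have h4 : 2 * 2.5 * r ≤ 2 * Real.exp 1 * r ^ (1 / (1 - t)) := by gcongr
    linarith
  have hA := isSumSq_of_posSemidef (idx d N) mono (gram τ (idx d N) c) (gram_symm _ _ _)
    (gram_posSemidef hτ0 _ _ c hpos)
  have hB := isSumSq_of_sum_abs_le (idx d N) (zero_mem_idx d N)
    (fun δ => c δ - avg τ (idx d N) c δ) (K := 3 / 4) (by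
      refine (sum_abs_sub_avg_le hτ0 c hc).trans ?_
      rw [hx, hτdef]
      exact averaging_estimate hx1 hM)
  have hE := isSumSq_of_dominant (idx d N) mono (fun β γ => -gramTail τ N (idx d N) c β γ)
    (fun β γ => by rw [gramTail, gramTail, add_comm, gram_symm])
    (fun β => √(weight t β)) (fun β => weight t β / 4)
    (fun β => Real.sqrt_pos.mpr (weight_pos t β)) (fun β _ => by
      simp only [abs_neg]
      exact sum_abs_gramTail_le hτ hr ht hN c hx (tail_estimate hx1 hd hNr) β)
  have hR : IsSumSq (∑ β ∈ idx d N, C (weight t β - weight t β / 4 - 3 / 4 / mfact β) *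
      mono β ^ 2) := by
    refine IsSumSq.sum fun β _ => isSumSq_C_mul ?_ (isSumSq_sq _)
    have := one_div_mfact_le_weight ht β
    have e : 3 / 4 / mfact β = 3 / 4 * (1 / mfact β) := by ring
    rw [e]
    linarith
  -- `hA` is average plus tail, `hB` restores the polynomial from its average, `hE` removes the
  -- tail, and `hR` is the unspent part of the weights.
  convert isSumSq_add (isSumSq_add hA hB) (isSumSq_add hE hR) using 1
  have hW : perturbation d t N =
      ∑ β ∈ idx d N, C (3 / 4 / mfact β) * mono β ^ 2 +
      (∑ β ∈ idx d N, C (weight t β / 4) * mono β ^ 2 +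
        ∑ β ∈ idx d N, C (weight t β - weight t β / 4 - 3 / 4 / mfact β) * mono β ^ 2) := by
    rw [perturbation_eq, ← Finset.sum_add_distrib, ← Finset.sum_add_distrib]
    refine Finset.sum_congr rfl fun β _ => ?_
    rw [← add_mul, ← add_mul, ← C_add, ← C_add]
    congr 2
    rw [weight]
    ring
  rw [sum_gram_mono hτ0, hW]
  simp only [C_sub, C_neg, sub_mul, neg_mul, Finset.sum_sub_distrib, Finset.sum_neg_distrib]
  ring

/-! ### Passage to polynomials and the final scaling -/

/-- The coefficients of a polynomial, indexed by functions. -/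
noncomputable def coeffFun (q : MvPolynomial (Fin d) ℝ) (α : Fin d → ℕ) : ℝ :=
  q.coeff (Finsupp.equivFunOnFinite.symm α)

lemma coeffFun_eq_zero {q : MvPolynomial (Fin d) ℝ} {D : ℕ} (hq : q.totalDegree ≤ D)
    (α : Fin d → ℕ) (hα : D < ∑ j, α j) : coeffFun q α = 0 := by
  refine coeff_eq_zero_of_totalDegree_lt ?_
  refine hq.trans_lt (hα.trans_le ?_)
  have := Finsupp.degree_eq_sum (Finsupp.equivFunOnFinite.symm α)
  rw [Finsupp.degree_apply] at this
  exact this.symm.le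

lemma sum_support_eq_sum_idx {A : Type*} [AddCommMonoid A] {q : MvPolynomial (Fin d) ℝ} {N : ℕ}
    (hq : q.totalDegree ≤ N) (F : (Fin d → ℕ) → ℝ → A) (hF : ∀ α, F α 0 = 0) :
    ∑ α ∈ q.support, F α (q.coeff α) = ∑ α ∈ idx d N, F α (coeffFun q α) := by
  classical
  have hinj : Function.Injective fun α : Fin d →₀ ℕ => (α : Fin d → ℕ) := DFunLike.coe_injective
  have e : ∑ α ∈ q.support, F α (q.coeff α) =
      ∑ α ∈ q.support.image (fun α : Fin d →₀ ℕ => (α : Fin d → ℕ)), F α (coeffFun q α) := by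
    rw [Finset.sum_image fun a _ b _ h => hinj h]
    refine Finset.sum_congr rfl fun α _ => ?_
    simp [coeffFun]
  rw [e]
  refine Finset.sum_subset ?_ ?_
  · intro β hβ
    obtain ⟨α, hα, rfl⟩ := Finset.mem_image.mp hβ
    rw [mem_idx]
    by_contra hcon
    push Not at hcon
    have := coeffFun_eq_zero hq _ hcon
    simp only [coeffFun, Finsupp.equivFunOnFinite_symm_coe] at this
    exact mem_support_iff.mp hα this
  · intro β _ hβ
    have : coeffFun q β = 0 := by
      by_contra hne
      exact hβ (Finset.mem_image.mpr ⟨Finsupp.equivFunOnFinite.symm β, mem_support_iff.mpr hne,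
        by simp⟩)
    rw [this, hF]

lemma coeffNorm_eq_sum_idx {q : MvPolynomial (Fin d) ℝ} {N : ℕ} (hq : q.totalDegree ≤ N) :
    coeffNorm q = ∑ α ∈ idx d N, |coeffFun q α| * √(mfact α) :=
  sum_support_eq_sum_idx hq (fun α a => |a| * √(mfact α)) (by simp)

lemma eq_sum_idx {q : MvPolynomial (Fin d) ℝ} {N : ℕ} (hq : q.totalDegree ≤ N) :
    q = ∑ α ∈ idx d N, C (coeffFun q α) * mono α := by
  rw [← sum_support_eq_sum_idx hq (fun α a => C a * mono α) (by simp)]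
  conv_lhs => rw [q.as_sum]
  refine Finset.sum_congr rfl fun α _ => ?_
  rw [monomial_eq, Finsupp.prod_fintype _ _ (by simp), mono]

lemma eval_eq_sum_idx {q : MvPolynomial (Fin d) ℝ} {N : ℕ} (hq : q.totalDegree ≤ N)
    (ξ : Fin d → ℝ) : eval ξ q = ∑ α ∈ idx d N, coeffFun q α * ∏ j, ξ j ^ α j := by
  conv_lhs => rw [eq_sum_idx hq]
  simp [mono]

/-- The case `ε = 1`. -/
lemma isSumSq_add_perturbation_Nexpl {M : ℕ} (hd : 1 ≤ d) (hM : 1 ≤ M)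
    (q : MvPolynomial (Fin d) ℝ) (hdeg : q.totalDegree ≤ 2 * M) {t : ℝ} (ht0 : 0 ≤ t) (ht1 : t < 1)
    (hq : ∀ ξ : Fin d → ℝ, 0 ≤ eval ξ q) :
    IsSumSq (q + perturbation d t (Nexpl M t q)) := by
  set N := Nexpl M t q with hN
  have hdegN : q.totalDegree ≤ N := hdeg.trans (two_mul_le_Nexpl M t q)
  have hx := (coeffNorm_eq_sum_idx hdegN).symm
  rw [show q + perturbation d t N =
    ∑ α ∈ idx d N, C (coeffFun q α) * mono α + perturbation d t N by rw [← eq_sum_idx hdegN]]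
  -- Averaging needs norm at least `1`, so that `τ ≥ 1` and `r ≥ 1`; smaller norms need no
  -- averaging.
  rcases le_total (coeffNorm q) 1 with h | h
  · exact isSumSq_add_perturbation_of_le_one ht1 _ (hx.trans_le h)
  · exact isSumSq_add_perturbation hd hM ht0 ht1 _ (coeffFun_eq_zero hdeg)
      (fun ξ => (hq ξ).trans_eq (eval_eq_sum_idx hdegN ξ)) hx h (two_exp_mul_rpow_le_Nexpl M t q)

end SOSPerturbation

theorem theorem2 (d M : ℕ) (hd : 1 ≤ d) (hM : 1 ≤ M)
    (p : MvPolynomial (Fin d) ℝ) (hdeg : p.totalDegree ≤ 2 * M)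
    (t : ℝ) (ht0 : 0 ≤ t) (ht1 : t < 1) (ε : ℝ) (hε : 0 < ε)
    (hp : ∀ ξ : Fin d → ℝ, 0 ≤ MvPolynomial.eval ξ p) :
    IsSumSq
      (p + MvPolynomial.C ε *
        SOSPerturbation.perturbation d t
          (SOSPerturbation.Nexpl M t (MvPolynomial.C ε⁻¹ * p))) := by
  set q := MvPolynomial.C ε⁻¹ * p with hq
  have hpq : p = MvPolynomial.C ε * q := by
    rw [hq, ← mul_assoc, ← MvPolynomial.C_mul, mul_inv_cancel₀ hε.ne', MvPolynomial.C_1, one_mul]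
  have hqdeg : q.totalDegree ≤ 2 * M := by
    refine (MvPolynomial.totalDegree_mul _ _).trans ?_
    rw [MvPolynomial.totalDegree_C, zero_add]
    exact hdeg
  have hqpos : ∀ ξ : Fin d → ℝ, 0 ≤ MvPolynomial.eval ξ q := by
    intro ξ
    rw [hq, map_mul, MvPolynomial.eval_C]
    exact mul_nonneg (inv_pos.mpr hε).le (hp ξ)
  have h := SOSPerturbation.isSumSq_C_mul hε.le
    (SOSPerturbation.isSumSq_add_perturbation_Nexpl hd hM q hqdeg ht0 ht1 hqpos)
  rw [mul_add, ← hpq] at h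
  exact h
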